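/- Let $V$ be a Euclidean space and let $\Phi\subseteq V$ be an irreducible (reduced) crystallographic root system of type $X_n$, spanning $V$, with simple roots $\Delta=\{\alpha_1,\dots,\alpha_n\}$. The height of a root $\sum_i a_i\alpha_i$ is $\sum_i a_i$; let $\tilde\alpha=\sum_{i=1}^n c_i\alpha_i$ be the highest root, put $c_0:=1$, and let $h:=1+\sum_{i=1}^n c_i$ be the Coxeter number. The inner product is normalized so that $\langle\tilde\alpha,\tilde\alpha\rangle=2$. Let $Q^\vee$ be the lattice generated by the coroots $\alpha^\vee=2\alpha/\|\alpha\|^2$, $\alpha\in\Phi$. Let $\omega_1^\vee,\dots,\omega_n^\vee$ be the basis of $V$ dual to $\alpha_1,\dots,\alpha_n$, let $\omega_0^\vee:=0$ and $\rho^\vee:=\sum_{i=1}^n\omega_i^\vee$. For $q\in Q^\vee$ and $0\le i\le n$ put $$\mathrm{size}_i^\vee(q):=\Big\langle \frac{c_i}{2}\,q-\omega_i^\vee,\;q\Big\rangle,\qquad \mathrm{size}^\vee(q):=\sum_{i=0}^n \mathrm{size}_i^\vee(q).$$ Let $b$ be a positive integer coprime to $h$, and write $b=th+r$ with integers $t\ge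 0$ and $0<r<h$. Let $$\mathcal S(b):=\{x\in V:\ \langle x,\alpha\rangle\ge -t \text{ for all roots } \alpha \text{ of height } r,\ \text{and } \langle x,\alpha\rangle\le t+1 \text{ for all roots } \alpha \text{ of height } h-r\}$$ and $\mathrm{core}(X_n,b):=Q^\vee\cap\mathcal S(b)$. Let $\mathcal A:=\{x\in V:\ \langle x,\alpha\rangle\ge 0\text{ for all }\alpha\in\Delta,\ \langle x,\tilde\alpha\rangle\le 1\}$ be the fundamental alcove, and for $x\in V$ put $$\mathrm{size}^{(b)}(x):=\frac h2\left(\Big\|x-\frac{b\rho^\vee}{h}\Big\|^2-\Big\|\frac{\rho^\vee}{h}\Big\|^2\right).$$ Then the sets $\mathrm{core}(X_n,b)$ and $b\mathcal A\cap Q^\vee$ are finite, and the following two multisets are equal: $$\{\mathrm{size}^\vee(q): q\in \mathrm{core}(X_n,b)\}=\{\mathrm{size}^{(b)}(q): q\in b\mathcal A\cap Q^\vee\}.$$ -/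

import Mathlib

open scoped Pointwise

noncomputable section

namespace AffineCore

/-- Let `V` be a real inner product space. A root pairing between `V` and itself is *Euclidean* if
the pairing between weight space and coweight space is the inner product of `V`, and the coroot of
each root `α` is `α^∨ = 2 α / ‖α‖²`. Thus roots, coroots, weights and coweights all live in `V`, and
the reflection attached to `α` is the orthogonal reflection
`x ↦ x - 2 ⟪α, x⟫ / ⟪α, α⟫ • α`. -/
structure IsEuclidean {ι V : Type*} [NormedAddCommGroup V] [InnerProductSpace ℝ V]
    (P : RootPairing ι ℝ V V) : Prop where
  toLinearMap_apply : ∀ x y : V, P.toLinearMap x y = inner ℝ x y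
  coroot_eq : ∀ i : ι, P.coroot i = (2 / ‖P.root i‖ ^ 2) • P.root i

section

variable {ι V : Type*} [NormedAddCommGroup V] [InnerProductSpace ℝ V]
  {P : RootPairing ι ℝ V V}

/-- `θ` is (the index of) a root of maximal height, i.e. the highest root `α̃`. -/
def IsHighestRoot (B : P.Base) (θ : ι) : Prop :=
  ∀ i : ι, B.height i ≤ B.height θ

/-- The Coxeter number `h = 1 + ht(α̃)`, where `θ` is the index of the highest root `α̃`. -/
def coxeterNumber (B : P.Base) (θ : ι) : ℤ :=
  1 + B.height θ

/-- The coroot lattice `Q^∨`: the lattice in `V` generated by the coroots. -/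
def corootLattice (P : RootPairing ι ℝ V V) : AddSubgroup V :=
  AddSubgroup.closure (Set.range P.coroot)

/-- The fundamental coweights `ω^∨_i`, `1 ≤ i ≤ n`: the basis of `V` dual to the basis of simple
roots (see `inner_fundamentalCoweight`). -/
def fundamentalCoweight [P.IsRootSystem] (B : P.Base) (i : B.support) : V :=
  P.flip.toPerfPair.symm (B.toWeightBasis.coord i)

/-- The defining property of the fundamental coweights: `⟪ω^∨_i, α_j⟫ = δ_{ij}`. -/
theorem inner_fundamentalCoweight [P.IsRootSystem] (hP : IsEuclidean P) (B : P.Base)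
    [DecidableEq B.support] (i j : B.support) :
    inner ℝ (fundamentalCoweight B i) (P.root j) = if i = j then (1 : ℝ) else 0 := by
  have h := P.flip.toLinearMap.apply_symm_toPerfPair_self (B.toWeightBasis.coord i)
  have h2 := LinearMap.congr_fun h (P.root j)
  rw [real_inner_comm, ← hP.toLinearMap_apply]
  refine Eq.trans h2 ?_
  simp [Finsupp.single_apply, eq_comm]

/-- `ρ^∨`, the sum of the fundamental coweights. -/
def rhoCheck [P.IsRootSystem] (B : P.Base) : V :=
  ∑ i : B.support, fundamentalCoweight B i

/-- The coefficients `c_0, c_1, …, c_n`, indexed by `Option B.support` with `none` in the role of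
the affine index `0`: `c_0 = 1`, and `α̃ = ∑_{i=1}^n c_i α_i` is the expansion of the highest root in
the simple roots. -/
def mark [P.IsRootSystem] (B : P.Base) (θ : ι) : Option B.support → ℝ
  | none => 1
  | some i => B.toWeightBasis.repr (P.root θ) i

/-- `ω^∨_0 = 0` together with the fundamental coweights `ω^∨_1, …, ω^∨_n`. -/
def affineCoweight [P.IsRootSystem] (B : P.Base) : Option B.support → V
  | none => 0
  | some i => fundamentalCoweight B i

/-- `size^∨_i(q) = ⟪(c_i / 2) q - ω^∨_i, q⟫` for `i ∈ {0, 1, …, n}`. -/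
def sizeCheckAt [P.IsRootSystem] (B : P.Base) (θ : ι) (i : Option B.support) (q : V) : ℝ :=
  inner ℝ ((mark B θ i / 2) • q - affineCoweight B i) q

/-- `size^∨(q) = ∑_{i=0}^n size^∨_i(q)`. -/
def sizeCheck [P.IsRootSystem] (B : P.Base) (θ : ι) (q : V) : ℝ :=
  ∑ i : Option B.support, sizeCheckAt B θ i q

/-- `size^{(b)}(x) = (h / 2) (‖x - b ρ^∨ / h‖² - ‖ρ^∨ / h‖²)`. -/
def sizeB [P.IsRootSystem] (B : P.Base) (θ : ι) (b : ℕ) (x : V) : ℝ :=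
  ((coxeterNumber B θ : ℝ) / 2) *
    (‖x - ((b : ℝ) / (coxeterNumber B θ : ℝ)) • rhoCheck B‖ ^ 2
      - ‖(1 / (coxeterNumber B θ : ℝ)) • rhoCheck B‖ ^ 2)

/-- The `b`-Sommers region. With `b = t h + r`, `0 ≤ r < h`, it is cut out by `⟪x, α⟫ ≥ -t` for the
roots `α` of height `r` and `⟪x, α⟫ ≤ t + 1` for the roots `α` of height `h - r`. (For `b` coprime to
`h` one has `0 < r < h`, so these are positive roots.) -/
def sommersRegion (B : P.Base) (θ : ι) (b : ℕ) : Set V :=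
  {x | (∀ i : ι, B.height i = (b : ℤ) % coxeterNumber B θ →
          -(((b : ℤ) / coxeterNumber B θ : ℤ) : ℝ) ≤ inner ℝ x (P.root i)) ∧
       (∀ i : ι, B.height i = coxeterNumber B θ - (b : ℤ) % coxeterNumber B θ →
          inner ℝ x (P.root i) ≤ (((b : ℤ) / coxeterNumber B θ : ℤ) : ℝ) + 1)}

/-- `core(X_n, b) = Q^∨ ∩ S(b)`. -/
def core (B : P.Base) (θ : ι) (b : ℕ) : Set V :=
  (corootLattice P : Set V) ∩ sommersRegion B θ b

/-- The fundamental alcove `A`: `⟪x, α⟫ ≥ 0` for all simple roots `α`, and `⟪x, α̃⟫ ≤ 1`. -/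
def alcove (B : P.Base) (θ : ι) : Set V :=
  {x | (∀ i ∈ B.support, 0 ≤ inner ℝ x (P.root i)) ∧ inner ℝ x (P.root θ) ≤ 1}

/-- The lattice points `bA ∩ Q^∨` of the `b`-fold dilation of the fundamental alcove. -/
def dilatedAlcovePoints (B : P.Base) (θ : ι) (b : ℕ) : Set V :=
  ((b : ℝ) • alcove B θ) ∩ (corootLattice P : Set V)

end

end AffineCore

end

/-! Since the marks sum to `h` and the affine coweights to `ρ^∨`, completing the square makes
`sizeCheck` the same function of the distance to `ρ^∨/h` as `sizeB` is of the distance to `bρ^∨/h`.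
It thus suffices to find an affine isometry `w = v + μ`, with `v` permuting the roots and `μ ∈ Q^∨`,
that carries `bρ^∨/h` to `ρ^∨/h`: it preserves `Q^∨`, and it maps `bA` onto `S(b)`.

Existence (`exists_permutesRoots_map_rhoCheck`): the point of the orbit of `bρ^∨/h` nearest to
`ρ^∨/h` lies in the interior of the fundamental alcove, and integrality leaves only `ρ^∨/h` there.

Regions (`add_mem_sommersRegion_iff`): both are written as families of lower bounds indexed by all
roots and governed by height; `w` changes heights by `ht ↦ b·ht` modulo `h`, which matches the two
families. -/

namespace AffineCore

/-! ### Positivity and uniqueness of the highest root. -/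

section HighestRoot

variable {ι V : Type*} [NormedAddCommGroup V] [InnerProductSpace ℝ V]
  {P : RootPairing ι ℝ V V}

theorem pairingIn_eq_sum [P.IsCrystallographic] {s : Finset ι} {i : ι} {f : ι → ℤ}
    (hf : P.root i = ∑ j ∈ s, f j • P.root j) (k : ι) :
    P.pairingIn ℤ i k = ∑ j ∈ s, f j * P.pairingIn ℤ j k := by
  have h : (P.pairingIn ℤ i k : ℝ) = ∑ j ∈ s, (f j : ℝ) * (P.pairingIn ℤ j k : ℝ) := by
    have h' (j : ι) : (P.pairingIn ℤ j k : ℝ) = P.toLinearMap (P.root j) (P.coroot k) := by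
      rw [P.root_coroot_eq_pairing]
      exact P.algebraMap_pairingIn ℤ j k
    simp only [h', hf, map_sum, map_zsmul, LinearMap.sum_apply, LinearMap.smul_apply,
      zsmul_eq_mul]
  exact_mod_cast h

theorem IsHighestRoot.height_pos [Nontrivial V] [P.IsRootSystem] {B : P.Base} {θ : ι}
    (hθ : IsHighestRoot B θ) : 0 < B.height θ := by
  have : Nonempty ι := ⟨θ⟩
  obtain ⟨i, hi⟩ := B.support_nonempty
  have := hθ i
  rw [RootPairing.Base.height_one_of_mem_support hi] at this
  lia

variable [Finite ι] [P.IsCrystallographic]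

theorem IsHighestRoot.pairingIn_nonneg {B : P.Base} {θ : ι}
    (hθ : IsHighestRoot B θ) {j : ι} (hj : j ∈ B.support) : 0 ≤ P.pairingIn ℤ θ j := by
  by_contra! h
  have hj1 := RootPairing.Base.height_one_of_mem_support hj
  by_cases h' : P.root θ = -P.root j
  · let := P.indexNeg
    have hn : P.root θ = P.root (-j) := by simp [h']
    have hh := B.height_reflectionPerm_self j
    rw [← P.root.injective hn, hj1] at hh
    have := hθ j
    lia
  · obtain ⟨k, hk⟩ := P.root_add_root_mem_of_pairingIn_neg h h'
    have h1 := B.height_add hk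
    have h2 := hθ k
    lia

variable [P.IsRootSystem] [P.IsReduced] [P.IsIrreducible]

/-- If `f j = 0`, the dominant pairing of `θ` with `α_j^∨` is a sum of nonpositive terms, so all
vanish and no neighbour of `j` has nonzero coefficient. Connectedness of the Dynkin diagram then
spreads nonvanishing to every node. -/
theorem IsHighestRoot.coeff_pos {B : P.Base} {θ : ι} (hθ : IsHighestRoot B θ) {f : ι → ℤ}
    (hf : P.root θ = ∑ j ∈ B.support, f j • P.root j) {j : ι} (hj : j ∈ B.support) :
    0 < f j := by
  have : Nontrivial V := RootPairing.IsIrreducible.nontrivial P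
  have hpos := hθ.height_pos
  have hsum := RootPairing.Base.height_eq_sum hf
  have hnn : ∀ j ∈ B.support, 0 ≤ f j := by
    obtain ⟨g, hg, hg', hgs⟩ := B.exists_root_eq_sum_int θ
    have hfg : ∀ j ∈ B.support, f j = g j := by
      have h0 : ∑ j ∈ B.support, ((f j - g j : ℤ) : ℝ) • P.root j = 0 := by
        simp only [Int.cast_smul_eq_zsmul, sub_smul, Finset.sum_sub_distrib, ← hf, ← hgs, sub_self]
      intro j hj
      have := (linearIndepOn_finset_iff.mp B.linearIndepOn_root) _ h0 j hj
      have : f j - g j = 0 := by exact_mod_cast this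
      lia
    rcases hg' with hg' | hg'
    · intro j hj
      rw [hfg j hj]
      exact hg'.le j
    · have : ∑ j ∈ B.support, f j ≤ 0 := Finset.sum_nonpos fun j hj ↦ by
        rw [hfg j hj]
        exact hg'.le j
      lia
  suffices h : f j ≠ 0 from lt_of_le_of_ne (hnn j hj) h.symm
  obtain ⟨i, hi, hi0⟩ : ∃ i ∈ B.support, f i ≠ 0 := by
    by_contra! h
    rw [hsum, Finset.sum_eq_zero h] at hpos
    exact lt_irrefl _ hpos
  refine B.induction_on_cartanMatrix (fun i ↦ f i ≠ 0) (i := ⟨i, hi⟩) (j := ⟨j, hj⟩) hi0 ?_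
  rintro ⟨i, hi⟩ ⟨j, hj⟩ hfi hij hfj
  simp only at hfi hfj
  have h1 := hθ.pairingIn_nonneg hj
  rw [pairingIn_eq_sum hf] at h1
  have h2 : ∀ k ∈ B.support, f k * P.pairingIn ℤ k j ≤ 0 := by
    intro k hk
    rcases eq_or_ne k j with rfl | hkj
    · simp [hfj]
    · exact mul_nonpos_of_nonneg_of_nonpos (hnn k hk) (B.pairingIn_le_zero_of_ne hkj hk hj)
  have h3 := (Finset.sum_eq_zero_iff_of_nonpos h2).mp (le_antisymm (Finset.sum_nonpos h2) h1) i hi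
  rw [mul_eq_zero, or_iff_right hfi] at h3
  exact hij (P.pairingIn_eq_zero_iff.mp h3)

/-- Two distinct roots of maximal height would pair positively, so their difference would be a root
of height `0`. -/
theorem IsHighestRoot.eq_of_height_eq {B : P.Base} {θ θ' : ι} (hθ : IsHighestRoot B θ)
    (h : B.height θ' = B.height θ) : θ' = θ := by
  have : Nontrivial V := RootPairing.IsIrreducible.nontrivial P
  have hθ' : IsHighestRoot B θ' := fun i ↦ h ▸ hθ i
  by_contra hne
  obtain ⟨f, -, -, hf⟩ := B.exists_root_eq_sum_int θ'
  have hpos : 0 < P.pairingIn ℤ θ' θ := by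
    rw [pairingIn_eq_sum hf]
    obtain ⟨j, hj, hj'⟩ :=
      RootPairing.Base.IsPos.exists_mem_support_pos_pairingIn (b := B) (i := θ) hθ.height_pos
    refine Finset.sum_pos' (fun i hi ↦ mul_nonneg (hθ'.coeff_pos hf hi).le ?_)
      ⟨j, hj, mul_pos (hθ'.coeff_pos hf hj) hj'⟩
    by_contra! hneg
    have h1 := hθ.pairingIn_nonneg hi
    rcases h1.eq_or_lt with h1 | h1
    · rw [P.pairingIn_eq_zero_iff.mp h1.symm] at hneg
      exact lt_irrefl _ hneg
    · rw [P.zero_lt_pairingIn_iff'] at h1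
      lia
  obtain ⟨k, hk⟩ := P.root_sub_root_mem_of_pairingIn_pos hpos hne
  apply B.height_ne_zero k
  rw [B.height_sub hk, h, sub_self]

end HighestRoot

/-! ### Reflections, the coroot lattice and affine orbits. -/

section Euclidean

variable {ι V : Type*} [NormedAddCommGroup V] [InnerProductSpace ℝ V]
  {P : RootPairing ι ℝ V V}

theorem IsEuclidean.pairing_eq (hP : IsEuclidean P) (i j : ι) :
    P.pairing i j = inner ℝ (P.coroot j) (P.root i) := by
  rw [← P.root_coroot_eq_pairing, hP.toLinearMap_apply, real_inner_comm]

theorem IsEuclidean.reflection_apply (hP : IsEuclidean P) (i : ι) (x : V) :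
    P.reflection i x = x - inner ℝ x (P.root i) • P.coroot i := by
  rw [P.reflection_apply, RootPairing.coroot', LinearMap.flip_apply, hP.toLinearMap_apply,
    hP.coroot_eq, inner_smul_right, smul_smul, mul_comm]

theorem norm_sq_root_pos (P : RootPairing ι ℝ V V) (i : ι) : 0 < ‖P.root i‖ ^ 2 := by
  have := norm_pos_iff.mpr (P.ne_zero i)
  positivity

/-- The change of the squared distance to `c` under the reflection in the affine hyperplane
`⟪x, α⟫ = k`. -/
theorem IsEuclidean.norm_sub_smul_coroot_sub_sq (hP : IsEuclidean P) (i : ι) (x c : V) (k : ℝ) :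
    ‖x - (inner ℝ x (P.root i) - k) • P.coroot i - c‖ ^ 2 = ‖x - c‖ ^ 2 +
      4 / ‖P.root i‖ ^ 2 * ((inner ℝ x (P.root i) - k) * (inner ℝ c (P.root i) - k)) := by
  have hpos := norm_sq_root_pos P i
  rw [sub_right_comm, norm_sub_sq_real, hP.coroot_eq, smul_smul, inner_smul_right, norm_smul,
    mul_pow, Real.norm_eq_abs, sq_abs, inner_sub_left]
  field_simp
  ring

theorem IsEuclidean.norm_reflection (hP : IsEuclidean P) (i : ι) (x : V) :
    ‖P.reflection i x‖ = ‖x‖ := by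
  have h := hP.norm_sub_smul_coroot_sub_sq i x 0 0
  rw [sub_zero, sub_zero, sub_zero, inner_zero_left, sub_zero, mul_zero, mul_zero, add_zero,
    ← hP.reflection_apply] at h
  exact (pow_left_inj₀ (norm_nonneg _) (norm_nonneg _) two_ne_zero).mp h

theorem IsEuclidean.exists_inner_eq_intCast [P.IsCrystallographic] (hP : IsEuclidean P) {q : V}
    (hq : q ∈ corootLattice P) (i : ι) : ∃ k : ℤ, inner ℝ q (P.root i) = (k : ℝ) := by
  induction hq using AddSubgroup.closure_induction with
  | mem x hx =>
    obtain ⟨j, rfl⟩ := hx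
    exact ⟨P.pairingIn ℤ i j, by rw [← hP.pairing_eq]; exact (P.algebraMap_pairingIn ℤ i j).symm⟩
  | zero => exact ⟨0, by simp⟩
  | add x y _ _ hx hy =>
    obtain ⟨k, hk⟩ := hx
    obtain ⟨l, hl⟩ := hy
    exact ⟨k + l, by simp [inner_add_left, hk, hl]⟩
  | neg x _ hx =>
    obtain ⟨k, hk⟩ := hx
    exact ⟨-k, by simp [hk]⟩

theorem coroot_mem_corootLattice (P : RootPairing ι ℝ V V) (i : ι) :
    P.coroot i ∈ corootLattice P :=
  AddSubgroup.subset_closure ⟨i, rfl⟩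

/-- The isometry `v` of `V` permutes the roots through `σ`. -/
def PermutesRoots (P : RootPairing ι ℝ V V) (v : V ≃ₗᵢ[ℝ] V) (σ : Equiv.Perm ι) : Prop :=
  ∀ i, v (P.root i) = P.root (σ i)

theorem PermutesRoots.symm {v : V ≃ₗᵢ[ℝ] V} {σ : Equiv.Perm ι} (h : PermutesRoots P v σ) :
    PermutesRoots P v.symm σ.symm := fun i ↦ by
  rw [v.symm_apply_eq, h, σ.apply_symm_apply]

theorem PermutesRoots.inner_apply {v : V ≃ₗᵢ[ℝ] V} {σ : Equiv.Perm ι} (h : PermutesRoots P v σ)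
    (x : V) (i : ι) : inner ℝ (v x) (P.root (σ i)) = inner ℝ x (P.root i) := by
  rw [← h, v.inner_map_map]

theorem PermutesRoots.map_mem_corootLattice {v : V ≃ₗᵢ[ℝ] V} {σ : Equiv.Perm ι}
    (h : PermutesRoots P v σ) (hP : IsEuclidean P) {q : V} (hq : q ∈ corootLattice P) :
    v q ∈ corootLattice P := by
  induction hq using AddSubgroup.closure_induction with
  | mem x hx =>
    obtain ⟨j, rfl⟩ := hx
    have : v (P.coroot j) = P.coroot (σ j) := by
      rw [hP.coroot_eq, hP.coroot_eq, map_smul, ← h, v.norm_map]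
    exact this ▸ coroot_mem_corootLattice P _
  | zero => simp
  | add x y _ _ hx hy => simpa using add_mem hx hy
  | neg x _ hx => simpa using hx

/-- The orbit of `p` under the group of affine isometries generated by the translations by the
coroot lattice and the linear isometries that permute the roots. -/
def affineOrbit (P : RootPairing ι ℝ V V) (p : V) : Set V :=
  {x | ∃ (v : V ≃ₗᵢ[ℝ] V) (σ : Equiv.Perm ι) (μ : V),
    PermutesRoots P v σ ∧ μ ∈ corootLattice P ∧ x = v p + μ}

theorem mem_affineOrbit_self (P : RootPairing ι ℝ V V) (p : V) : p ∈ affineOrbit P p :=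
  ⟨LinearIsometryEquiv.refl ℝ V, Equiv.refl ι, 0, fun _ ↦ rfl, zero_mem _, by simp⟩

theorem IsEuclidean.affineReflection_mem_affineOrbit [P.IsCrystallographic] (hP : IsEuclidean P)
    {p x : V} (hx : x ∈ affineOrbit P p) (i : ι) (k : ℤ) :
    x - (inner ℝ x (P.root i) - k) • P.coroot i ∈ affineOrbit P p := by
  obtain ⟨v, σ, μ, hv, hμ, rfl⟩ := hx
  obtain ⟨l, hl⟩ := hP.exists_inner_eq_intCast hμ i
  -- Only `v p` is reflected; as `⟪μ, α⟫ = l`, the remaining translation is `μ + (k - l) α^∨`.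
  refine ⟨v.trans ⟨P.reflection i, hP.norm_reflection i⟩, σ.trans (P.reflectionPerm i),
    μ + (k - l) • P.coroot i, fun j ↦ ?_,
    add_mem hμ (zsmul_mem (coroot_mem_corootLattice P i) _), ?_⟩
  · change P.reflection i (v (P.root j)) = P.root (P.reflectionPerm i (σ j))
    rw [hv, P.root_reflectionPerm]
  · change _ = P.reflection i (v p) + _
    rw [hP.reflection_apply, inner_add_left, hl, ← Int.cast_smul_eq_zsmul ℝ]
    push_cast
    module

end Euclidean

/-! ### Completing the square, and discreteness of orbits. -/

section RootSystem

variable {ι V : Type*} [NormedAddCommGroup V] [InnerProductSpace ℝ V]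
  {P : RootPairing ι ℝ V V} [P.IsRootSystem]

theorem inner_rhoCheck (hP : IsEuclidean P) (B : P.Base) (i : ι) :
    inner ℝ (rhoCheck B) (P.root i) = (B.height i : ℝ) := by
  classical
  obtain ⟨f, -, -, hf⟩ := B.exists_root_eq_sum_int i
  have h1 : ∀ j ∈ B.support, inner ℝ (rhoCheck B) (P.root j) = (1 : ℝ) := by
    intro j hj
    rw [rhoCheck, sum_inner]
    have := fun i ↦ inner_fundamentalCoweight hP B i ⟨j, hj⟩
    simp [this]
  rw [RootPairing.Base.height_eq_sum hf, hf, inner_sum, Int.cast_sum]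
  refine Finset.sum_congr rfl fun j hj ↦ ?_
  rw [← Int.cast_smul_eq_zsmul ℝ, inner_smul_right, h1 j hj, mul_one]

theorem repr_root_eq_intCast (B : P.Base) {i : ι} {f : ι → ℤ}
    (hf : P.root i = ∑ j ∈ B.support, f j • P.root j) (j : B.support) :
    B.toWeightBasis.repr (P.root i) j = f j := by
  have h : P.root i = ∑ j : B.support, (f j : ℝ) • B.toWeightBasis j := by
    rw [hf, ← Finset.sum_coe_sort]
    simp [Int.cast_smul_eq_zsmul]
  rw [h, B.toWeightBasis.repr_sum_self fun j : B.support ↦ (f j : ℝ)]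

theorem sum_mark (B : P.Base) (θ : ι) : ∑ i, mark B θ i = coxeterNumber B θ := by
  obtain ⟨f, -, -, hf⟩ := B.exists_root_eq_sum_int θ
  rw [Fintype.sum_option, coxeterNumber, RootPairing.Base.height_eq_sum hf,
    ← Finset.sum_coe_sort B.support]
  simp [mark, repr_root_eq_intCast B hf]

theorem sum_affineCoweight (B : P.Base) : ∑ i, affineCoweight B i = rhoCheck B := by
  rw [Fintype.sum_option]
  simp [affineCoweight, rhoCheck]

theorem sizeCheck_eq (B : P.Base) (θ : ι) (q : V) :
    sizeCheck B θ q = (coxeterNumber B θ : ℝ) / 2 * ‖q‖ ^ 2 - inner ℝ (rhoCheck B) q := by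
  rw [← sum_mark, ← sum_affineCoweight, sum_inner, Finset.sum_div, Finset.sum_mul,
    ← Finset.sum_sub_distrib]
  refine Finset.sum_congr rfl fun i _ ↦ ?_
  rw [sizeCheckAt, inner_sub_left, real_inner_smul_left, real_inner_self_eq_norm_sq]

theorem sizeCheck_eq_norm_sq (B : P.Base) {θ : ι} (h : coxeterNumber B θ ≠ 0) (q : V) :
    sizeCheck B θ q = (coxeterNumber B θ : ℝ) / 2 *
      (‖q - (1 / (coxeterNumber B θ : ℝ)) • rhoCheck B‖ ^ 2
        - ‖(1 / (coxeterNumber B θ : ℝ)) • rhoCheck B‖ ^ 2) := by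
  have h' : (coxeterNumber B θ : ℝ) ≠ 0 := by exact_mod_cast h
  rw [sizeCheck_eq, norm_sub_sq_real, inner_smul_right, real_inner_comm]
  field_simp
  ring

/-- Used with `N = 1` for lattice points of `bA` and with `N = h` for the orbit of `bρ^∨/h`. -/
theorem finite_setOf_inner_eq_intCast_div [Finite ι] (B : P.Base) {N : ℝ} (hN : N ≠ 0) (C : ℝ) :
    {x : V | ∀ i ∈ B.support, (∃ k : ℤ, N * inner ℝ x (P.root i) = k) ∧
      |inner ℝ x (P.root i)| ≤ C}.Finite := by
  let F : V → B.support → ℝ := fun x i ↦ N * inner ℝ x (P.root i)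
  have hF : Function.Injective F := by
    intro x y hxy
    refine InnerProductSpace.ext_inner_right_basis B.toWeightBasis fun i ↦ ?_
    rw [B.toWeightBasis_apply]
    exact mul_left_cancel₀ hN (congrFun hxy i)
  refine Set.Finite.of_finite_image (f := F) (Set.Finite.subset (Set.Finite.pi'
    fun _ : B.support ↦ (Set.finite_Icc (-⌈|N| * C⌉) ⌈|N| * C⌉).image ((↑) : ℤ → ℝ)) ?_)
    hF.injOn
  rintro _ ⟨x, hx, rfl⟩ ⟨i, hi⟩
  obtain ⟨⟨k, hk⟩, hC⟩ := hx i hi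
  refine ⟨k, ?_, hk.symm⟩
  rw [Set.mem_Icc, ← abs_le]
  have : |(k : ℝ)| ≤ |N| * C := by
    rw [← hk, abs_mul]
    gcongr
  exact_mod_cast this.trans (Int.le_ceil _)

theorem IsEuclidean.exists_mem_affineOrbit_forall_norm_le [Finite ι] [P.IsCrystallographic]
    (hP : IsEuclidean P) (B : P.Base) {N : ℤ} (hN : N ≠ 0) {p : V}
    (hp : ∀ i, ∃ k : ℤ, (N : ℝ) * inner ℝ p (P.root i) = k) (c : V) :
    ∃ x ∈ affineOrbit P p, ∀ y ∈ affineOrbit P p, ‖x - c‖ ≤ ‖y - c‖ := by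
  have := Fintype.ofFinite ι
  set S := affineOrbit P p ∩ {x | ‖x - c‖ ≤ ‖p - c‖} with hS
  have hfin : S.Finite := by
    refine (finite_setOf_inner_eq_intCast_div B (Int.cast_ne_zero.mpr hN)
      ((‖p - c‖ + ‖c‖) * ∑ i, ‖P.root i‖)).subset ?_
    rintro x ⟨⟨v, σ, μ, hv, hμ, rfl⟩, hx⟩ i -
    constructor
    · obtain ⟨k, hk⟩ := hp (σ.symm i)
      obtain ⟨l, hl⟩ := hP.exists_inner_eq_intCast hμ i
      refine ⟨k + N * l, ?_⟩
      have h1 := hv.inner_apply p (σ.symm i)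
      rw [σ.apply_symm_apply] at h1
      rw [inner_add_left, h1, mul_add, hk, hl]
      push_cast
      rfl
    · refine (abs_real_inner_le_norm _ _).trans ?_
      gcongr
      · change ‖v p + μ - c‖ ≤ _ at hx
        have := norm_sub_norm_le (v p + μ) c
        linarith
      · exact Finset.single_le_sum (f := fun i ↦ ‖P.root i‖) (fun _ _ ↦ norm_nonneg _)
          (Finset.mem_univ i)
  obtain ⟨x, hx, hmin⟩ := Set.exists_min_image S (fun x ↦ ‖x - c‖) hfin
    ⟨p, mem_affineOrbit_self P p, le_refl ‖p - c‖⟩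
  refine ⟨x, hx.1, fun y hy ↦ ?_⟩
  by_cases h : ‖y - c‖ ≤ ‖p - c‖
  · exact hmin y ⟨hy, h⟩
  · exact hx.2.trans (not_le.mp h).le

end RootSystem

/-! ### The Sommers region, the dilated alcove and the isometry between them. -/

section Main

variable {ι V : Type*} [NormedAddCommGroup V] [InnerProductSpace ℝ V]
  {P : RootPairing ι ℝ V V} {B : P.Base} {θ : ι} {b : ℕ}

theorem IsHighestRoot.abs_height_lt (hθ : IsHighestRoot B θ) (i : ι) :
    |B.height i| < coxeterNumber B θ := by
  let := P.indexNeg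
  have h1 := hθ i
  have h2 := hθ (-i)
  rw [B.height_reflectionPerm_self] at h2
  rw [abs_lt, coxeterNumber]
  constructor <;> lia

theorem IsHighestRoot.coxeterNumber_gt_one [Nontrivial V] [P.IsRootSystem]
    (hθ : IsHighestRoot B θ) : 1 < coxeterNumber B θ := by
  have := hθ.height_pos
  rw [coxeterNumber]
  lia

theorem IsHighestRoot.not_dvd_mul_height (hθ : IsHighestRoot B θ)
    (hb : IsCoprime (b : ℤ) (coxeterNumber B θ)) (i : ι) :
    ¬ coxeterNumber B θ ∣ b * B.height i := fun h ↦
  B.height_ne_zero i (Int.eq_zero_of_abs_lt_dvd (hb.symm.dvd_of_dvd_mul_left h)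
    (hθ.abs_height_lt i))

/-- Upper bounds for `α` are lower bounds for `-α`. As heights lie strictly between `-h` and `h` and
`0 < r < h`, only `k = -t` and `k = -t - 1` occur. -/
theorem mem_sommersRegion_iff (hθ : IsHighestRoot B θ) (hh : 1 < coxeterNumber B θ)
    (hb : IsCoprime (b : ℤ) (coxeterNumber B θ)) (y : V) :
    y ∈ sommersRegion B θ b ↔ ∀ (i : ι) (k : ℤ), B.height i = b + coxeterNumber B θ * k →
      (k : ℝ) ≤ inner ℝ y (P.root i) := by
  have hdiv := Int.emod_add_mul_ediv (b : ℤ) (coxeterNumber B θ)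
  have hr0 := Int.emod_nonneg (b : ℤ) (b := coxeterNumber B θ) (by lia)
  have hrh := Int.emod_lt_of_pos (b : ℤ) (b := coxeterNumber B θ) (by lia)
  have hr : (b : ℤ) % coxeterNumber B θ ≠ 0 := fun h ↦ by
    have := hb.symm.isUnit_of_dvd' dvd_rfl (Int.dvd_of_emod_eq_zero h)
    rw [Int.isUnit_iff] at this
    lia
  have habs (i : ι) := abs_lt.mp (hθ.abs_height_lt i)
  have hneg := fun i ↦ B.height_reflectionPerm_self i
  have hroot (i : ι) : P.root (P.reflectionPerm i i) = -P.root i := by simp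
  rw [sommersRegion]
  generalize coxeterNumber B θ = h at *
  generalize (b : ℤ) / h = t at *
  generalize (b : ℤ) % h = r at *
  constructor
  · rintro ⟨h1, h2⟩ i k hk
    have hi := habs i
    have hk' : B.height i = r + h * (t + k) := by rw [hk, ← hdiv]; ring
    have hlt : t + k < 1 := by nlinarith
    have hgt : -2 < t + k := by nlinarith
    obtain hc | hc : t + k = 0 ∨ t + k = -1 := by lia
    · have := h1 i (by rw [hk', hc]; ring)
      rwa [show k = -t by lia, Int.cast_neg]
    · have h3 := h2 (P.reflectionPerm i i) (by
        refine (hneg i).trans ?_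
        rw [hk', hc]
        ring)
      rw [hroot, inner_neg_right] at h3
      rw [show k = -t - 1 by lia]
      push_cast
      linarith
  · intro H
    refine ⟨fun i hi ↦ ?_, fun i hi ↦ ?_⟩
    · have := H i (-t) (by rw [hi, ← hdiv]; ring)
      rwa [Int.cast_neg] at this
    · have := H (P.reflectionPerm i i) (-t - 1) (by
        refine (hneg i).trans ?_
        rw [hi, ← hdiv]
        ring)
      rw [hroot, inner_neg_right] at this
      push_cast at this
      linarith

theorem inner_root_nonneg {x : V} (hx : ∀ i ∈ B.support, 0 ≤ inner ℝ x (P.root i)) {i : ι}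
    (hi : 0 < B.height i) : 0 ≤ inner ℝ x (P.root i) := by
  obtain ⟨f, -, hf', hf⟩ := B.exists_root_eq_sum_int i
  rw [RootPairing.Base.height_eq_sum hf] at hi
  rcases hf' with hf' | hf'
  · rw [hf, inner_sum]
    refine Finset.sum_nonneg fun j hj ↦ ?_
    rw [← Int.cast_smul_eq_zsmul ℝ, inner_smul_right]
    exact mul_nonneg (Int.cast_nonneg (hf'.le j)) (hx j hj)
  · exact absurd (Finset.sum_nonpos fun j _ ↦ hf'.le j) (not_le.mpr hi)

theorem mem_smul_alcove_iff (hb : 0 < b) (x : V) :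
    x ∈ (b : ℝ) • alcove B θ ↔
      (∀ i ∈ B.support, 0 ≤ inner ℝ x (P.root i)) ∧ inner ℝ x (P.root θ) ≤ b := by
  have hb' : (0 : ℝ) < b := Nat.cast_pos.mpr hb
  rw [Set.mem_smul_set_iff_inv_smul_mem₀ hb'.ne', alcove, Set.mem_ofPred_eq]
  simp only [real_inner_smul_left]
  refine and_congr (forall₂_congr fun i _ ↦ ?_) ?_
  · rw [mul_nonneg_iff_of_pos_left (inv_pos.mpr hb')]
  · rw [inv_mul_le_iff₀ hb', mul_one]

variable [Finite ι] [P.IsCrystallographic] [P.IsRootSystem]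

theorem dilatedAlcovePoints_finite [P.IsReduced] [P.IsIrreducible] (hP : IsEuclidean P)
    (hθ : IsHighestRoot B θ) (hb : 0 < b) : (dilatedAlcovePoints B θ b).Finite := by
  refine (finite_setOf_inner_eq_intCast_div B one_ne_zero (b : ℝ)).subset ?_
  rintro x ⟨hx, hxQ⟩ i hi
  refine ⟨by simpa using hP.exists_inner_eq_intCast hxQ i, ?_⟩
  rw [mem_smul_alcove_iff hb] at hx
  rw [abs_of_nonneg (hx.1 i hi)]
  refine le_trans ?_ hx.2
  obtain ⟨f, -, -, hf⟩ := B.exists_root_eq_sum_int θ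
  rw [hf, inner_sum]
  simp only [← Int.cast_smul_eq_zsmul ℝ, inner_smul_right]
  have hpos (j : ι) (hj : j ∈ B.support) : (1 : ℝ) ≤ f j := by
    exact_mod_cast hθ.coeff_pos hf hj
  calc inner ℝ x (P.root i) ≤ f i * inner ℝ x (P.root i) :=
        le_mul_of_one_le_left (hx.1 i hi) (hpos i hi)
    _ ≤ _ := Finset.single_le_sum (f := fun j ↦ (f j : ℝ) * inner ℝ x (P.root j))
        (fun j hj ↦ mul_nonneg (zero_le_one.trans (hpos j hj)) (hx.1 j hj)) hi

variable [P.IsReduced] [P.IsIrreducible]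

/-- Coprimality forces `h ∣ ht α - 1`, so `ht α` is `1` or `1 - h`. The latter means `α = -α̃`, by
uniqueness of the highest root. -/
theorem mem_smul_alcove_iff_forall (hθ : IsHighestRoot B θ) (hb0 : 0 < b)
    (hb : IsCoprime (b : ℤ) (coxeterNumber B θ)) (x : V) :
    x ∈ (b : ℝ) • alcove B θ ↔ ∀ (i : ι) (l : ℤ),
      b * (B.height i - 1) = coxeterNumber B θ * l → (l : ℝ) ≤ inner ℝ x (P.root i) := by
  have : Nontrivial V := RootPairing.IsIrreducible.nontrivial P
  have hh := hθ.coxeterNumber_gt_one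
  have hneg := fun i ↦ B.height_reflectionPerm_self i
  have hroot (i : ι) : P.root (P.reflectionPerm i i) = -P.root i := by simp
  rw [mem_smul_alcove_iff hb0]
  constructor
  · rintro ⟨h1, h2⟩ i l hl
    obtain ⟨m, hm⟩ : coxeterNumber B θ ∣ B.height i - 1 :=
      hb.symm.dvd_of_dvd_mul_left ⟨l, hl⟩
    have hi := abs_lt.mp (hθ.abs_height_lt i)
    have hlm : l = b * m := by
      refine mul_left_cancel₀ (a := coxeterNumber B θ) (by lia) ?_
      rw [← hl, hm]
      ring
    have hi0 := B.height_ne_zero i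
    have hm1 : m < 1 := by nlinarith
    have hm2 : -2 < m := by nlinarith
    obtain rfl | rfl : m = 0 ∨ m = -1 := by lia
    · rw [hlm, mul_zero, Int.cast_zero]
      exact inner_root_nonneg h1 (by lia)
    · have hi' : P.reflectionPerm i i = θ := hθ.eq_of_height_eq (by
        refine (hneg i).trans ?_
        rw [coxeterNumber] at hm
        lia)
      rw [← hi', hroot, inner_neg_right] at h2
      rw [hlm]
      push_cast
      linarith
  · intro H
    refine ⟨fun i hi ↦ ?_, ?_⟩
    · have := H i 0 (by rw [RootPairing.Base.height_one_of_mem_support hi]; ring)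
      simpa using this
    · have := H (P.reflectionPerm θ θ) (-b) (by
        rw [show B.height (P.reflectionPerm θ θ) = -B.height θ from hneg θ, coxeterNumber]
        ring)
      rw [hroot, inner_neg_right] at this
      push_cast at this
      linarith

theorem exists_permutesRoots_map_rhoCheck (hP : IsEuclidean P) (hθ : IsHighestRoot B θ)
    (hb : IsCoprime (b : ℤ) (coxeterNumber B θ)) :
    ∃ (v : V ≃ₗᵢ[ℝ] V) (σ : Equiv.Perm ι) (μ : V), PermutesRoots P v σ ∧ μ ∈ corootLattice P ∧
      v (((b : ℝ) / (coxeterNumber B θ : ℝ)) • rhoCheck B) + μ =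
        (1 / (coxeterNumber B θ : ℝ)) • rhoCheck B := by
  have : Nontrivial V := RootPairing.IsIrreducible.nontrivial P
  have hh := hθ.coxeterNumber_gt_one
  have hdvd := hθ.not_dvd_mul_height hb
  have hhθ : coxeterNumber B θ = 1 + B.height θ := rfl
  generalize coxeterNumber B θ = h at *
  have hhR : (0 : ℝ) < h := by exact_mod_cast (by lia : 0 < h)
  set p : V := ((b : ℝ) / (h : ℝ)) • rhoCheck B with hp
  set c : V := (1 / (h : ℝ)) • rhoCheck B with hc
  have hpi (i : ι) : (h : ℝ) * inner ℝ p (P.root i) = ((b * B.height i : ℤ) : ℝ) := by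
    rw [hp, real_inner_smul_left, inner_rhoCheck hP]
    push_cast
    field_simp
  have hci (i : ι) : (h : ℝ) * inner ℝ c (P.root i) = B.height i := by
    rw [hc, real_inner_smul_left, inner_rhoCheck hP]
    field_simp
  obtain ⟨x, hx, hmin⟩ := hP.exists_mem_affineOrbit_forall_norm_le B (N := h) (by lia)
    (fun i ↦ ⟨_, hpi i⟩) c
  -- Reflecting `x` in `⟪·, α⟫ = k` cannot bring it nearer to `c`, so no such hyperplane strictly
  -- separates them.
  have hside (i : ι) (k : ℤ) :
      0 ≤ ((h : ℝ) * inner ℝ x (P.root i) - h * k) * ((B.height i : ℝ) - h * k) := by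
    have h1 := hmin _ (hP.affineReflection_mem_affineOrbit hx i k)
    rw [← pow_le_pow_iff_left₀ (norm_nonneg _) (norm_nonneg _) two_ne_zero,
      hP.norm_sub_smul_coroot_sub_sq, le_add_iff_nonneg_right,
      mul_nonneg_iff_of_pos_left (div_pos four_pos (norm_sq_root_pos P i))] at h1
    rw [← hci, ← mul_sub, ← mul_sub, mul_mul_mul_comm]
    exact mul_nonneg (mul_nonneg hhR.le hhR.le) h1
  -- Coprimality keeps the orbit off all these hyperplanes, so the inequalities become strict.
  have hK (i : ι) : ∃ K : ℤ, (h : ℝ) * inner ℝ x (P.root i) = K ∧ ¬ h ∣ K := by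
    obtain ⟨v, σ, μ, hv, hμ, rfl⟩ := hx
    obtain ⟨l, hl⟩ := hP.exists_inner_eq_intCast hμ i
    have h1 := hv.inner_apply p (σ.symm i)
    rw [σ.apply_symm_apply] at h1
    refine ⟨b * B.height (σ.symm i) + h * l, ?_, ?_⟩
    · rw [inner_add_left, h1, mul_add, hpi, hl]
      push_cast
      rfl
    · rw [Int.dvd_add_left (dvd_mul_right _ _)]
      exact hdvd _
  choose K hK hKdvd using hK
  have hsideK (i : ι) (k : ℤ) : 0 ≤ (K i - h * k) * (B.height i - h * k) := by
    have := hside i k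
    rw [hK] at this
    exact_mod_cast this
  have hKpos : ∀ i ∈ B.support, 1 ≤ K i := by
    intro i hi
    have h1 := hsideK i 0
    rw [RootPairing.Base.height_one_of_mem_support hi] at h1
    have h2 : K i ≠ 0 := fun h2 ↦ hKdvd i (h2 ▸ dvd_zero h)
    lia
  have hKθ : K θ ≤ h - 1 := by
    have h1 := hsideK θ 1
    have h2 : K θ ≠ h := fun h2 ↦ hKdvd θ (by rw [h2])
    rw [show B.height θ = h - 1 by lia] at h1
    lia
  obtain ⟨f, -, -, hf⟩ := B.exists_root_eq_sum_int θ
  have hsum : ∑ j ∈ B.support, f j * K j = K θ := by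
    have : ∑ j ∈ B.support, (f j : ℝ) * (K j : ℝ) = K θ := by
      rw [← hK θ, hf, inner_sum, Finset.mul_sum]
      refine Finset.sum_congr rfl fun j _ ↦ ?_
      rw [← hK j, ← Int.cast_smul_eq_zsmul ℝ, inner_smul_right]
      ring
    exact_mod_cast this
  have hht := RootPairing.Base.height_eq_sum hf
  have hnn : ∀ j ∈ B.support, 0 ≤ f j * (K j - 1) := fun j hj ↦
    mul_nonneg (hθ.coeff_pos hf hj).le (by linarith [hKpos j hj])
  -- The sum is `K θ - (h - 1) ≤ 0` with nonnegative terms; since the marks are positive, every `K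
  -- j` is `1`.
  have hzero : ∑ j ∈ B.support, f j * (K j - 1) = 0 := by
    refine le_antisymm ?_ (Finset.sum_nonneg hnn)
    simp only [mul_sub, mul_one, Finset.sum_sub_distrib, hsum, ← hht]
    lia
  have hxc : x = c := by
    refine InnerProductSpace.ext_inner_right_basis B.toWeightBasis fun i ↦ ?_
    rw [B.toWeightBasis_apply]
    refine mul_left_cancel₀ hhR.ne' ?_
    have h1 := (Finset.sum_eq_zero_iff_of_nonneg hnn).mp hzero i i.2
    rw [mul_eq_zero, or_iff_right (hθ.coeff_pos hf i.2).ne', sub_eq_zero] at h1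
    rw [hK, h1, hci, RootPairing.Base.height_one_of_mem_support i.2]
  obtain ⟨v, σ, μ, hv, hμ, hx⟩ := hx
  exact ⟨v, σ, μ, hv, hμ, by rw [← hx, hxc]⟩

/-- An affine isometry that carries `b ρ^∨ / h` to `ρ^∨ / h` maps the dilated alcove onto the
Sommers region. -/
theorem add_mem_sommersRegion_iff (hP : IsEuclidean P) (hθ : IsHighestRoot B θ) (hb0 : 0 < b)
    (hb : IsCoprime (b : ℤ) (coxeterNumber B θ)) {v : V ≃ₗᵢ[ℝ] V} {σ : Equiv.Perm ι} {μ : V}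
    (hv : PermutesRoots P v σ) (hμ : μ ∈ corootLattice P)
    (h : v (((b : ℝ) / (coxeterNumber B θ : ℝ)) • rhoCheck B) + μ =
      (1 / (coxeterNumber B θ : ℝ)) • rhoCheck B) (x : V) :
    v x + μ ∈ sommersRegion B θ b ↔ x ∈ (b : ℝ) • alcove B θ := by
  have : Nontrivial V := RootPairing.IsIrreducible.nontrivial P
  have hh := hθ.coxeterNumber_gt_one
  rw [mem_sommersRegion_iff hθ hh hb, mem_smul_alcove_iff_forall hθ hb0 hb,
    ← σ.forall_congr_right]
  refine forall_congr' fun i ↦ ?_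
  obtain ⟨m, hm⟩ := hP.exists_inner_eq_intCast hμ (σ i)
  -- Pair `h` with the root `σ i`. The two index conditions then correspond under `k = l + m`.
  have hht : B.height (σ i) = b * B.height i + coxeterNumber B θ * m := by
    have h1 := congrArg (fun y ↦ inner ℝ y (P.root (σ i))) h
    simp only [inner_add_left, hv.inner_apply, hm, real_inner_smul_left, inner_rhoCheck hP] at h1
    have hhR : (coxeterNumber B θ : ℝ) ≠ 0 := by
      exact_mod_cast (by lia : coxeterNumber B θ ≠ 0)
    field_simp at h1
    exact_mod_cast h1.symm
  rw [inner_add_left, hv.inner_apply, hm, hht]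
  refine ⟨fun H l hl ↦ ?_, fun H k hk ↦ ?_⟩
  · have := H (l + m) (by linear_combination hl)
    push_cast at this
    linarith
  · have := H (k - m) (by linear_combination hk)
    push_cast at this
    linarith

end Main

end AffineCore

theorem theorem6p2 {ι V : Type*} [Finite ι]
    [NormedAddCommGroup V] [InnerProductSpace ℝ V] [FiniteDimensional ℝ V]
    (P : RootPairing ι ℝ V V) [P.IsRootSystem] [P.IsCrystallographic] [P.IsReduced]
    [P.IsIrreducible] (hP : AffineCore.IsEuclidean P)
    (B : P.Base) (θ : ι) (hθ : AffineCore.IsHighestRoot B θ)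
    (hnorm : inner ℝ (P.root θ) (P.root θ) = (2 : ℝ))
    (b : ℕ) (hb : IsCoprime (b : ℤ) (AffineCore.coxeterNumber B θ)) :
    ∃ (hcore : (AffineCore.core B θ b).Finite)
      (halc : (AffineCore.dilatedAlcovePoints B θ b).Finite),
      hcore.toFinset.val.map (AffineCore.sizeCheck B θ) =
        halc.toFinset.val.map (AffineCore.sizeB B θ b) := by
  have : Nontrivial V := RootPairing.IsIrreducible.nontrivial P
  have hh := hθ.coxeterNumber_gt_one
  have hb0 : 0 < b := by
    refine Nat.pos_of_ne_zero fun h ↦ ?_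
    rw [h, Nat.cast_zero, isCoprime_zero_left, Int.isUnit_iff] at hb
    lia
  obtain ⟨v, σ, μ, hv, hμ, hρ⟩ := AffineCore.exists_permutesRoots_map_rhoCheck hP hθ hb
  have halc := AffineCore.dilatedAlcovePoints_finite (b := b) hP hθ hb0
  let w : V ↪ V := ⟨fun x ↦ v x + μ, (add_left_injective μ).comp v.injective⟩
  have hQ (x : V) : w x ∈ AffineCore.corootLattice P ↔ x ∈ AffineCore.corootLattice P := by
    rw [show w x = v x + μ from rfl, add_mem_cancel_right hμ]
    refine ⟨fun h ↦ ?_, hv.map_mem_corootLattice hP⟩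
    simpa using hv.symm.map_mem_corootLattice hP h
  have hcore : AffineCore.core B θ b = w '' AffineCore.dilatedAlcovePoints B θ b := by
    ext y
    obtain ⟨x, rfl⟩ : ∃ x, w x = y := ⟨v.symm (y - μ), by simp [w]⟩
    rw [w.injective.mem_set_image, AffineCore.core, AffineCore.dilatedAlcovePoints,
      Set.mem_inter_iff, Set.mem_inter_iff, and_comm]
    exact and_congr (AffineCore.add_mem_sommersRegion_iff hP hθ hb0 hb hv hμ hρ x) (hQ x)
  refine ⟨hcore ▸ halc.image w, halc, ?_⟩
  have hmap : (hcore ▸ halc.image w : (AffineCore.core B θ b).Finite).toFinset =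
      halc.toFinset.map w := by
    ext y
    simp [hcore]
  rw [hmap, Finset.map_val, Multiset.map_map]
  refine Multiset.map_congr rfl fun x _ ↦ ?_
  rw [Function.comp_apply, AffineCore.sizeCheck_eq_norm_sq B (by lia), AffineCore.sizeB]
  have hnorm_eq : ‖w x - (1 / (AffineCore.coxeterNumber B θ : ℝ)) • AffineCore.rhoCheck B‖ =
      ‖x - ((b : ℝ) / (AffineCore.coxeterNumber B θ : ℝ)) • AffineCore.rhoCheck B‖ := by
    rw [← hρ, show w x = v x + μ from rfl, add_sub_add_right_eq_sub, ← map_sub, v.norm_map]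
  rw [hnorm_eq]
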